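/- Let $S$ be a real or complex pre-Hilbert space (inner product space). For $A\subseteq S$ put $A^{\perp}=\{x\in S:\langle x,a\rangle=0\ \forall a\in A\}$. A \emph{pre-Hilbert space logic} is a pair $(S,\mathcal L)$, where $\mathcal L$ is a family of linear subspaces $M$ of $S$ with $M=M^{\perp\perp}$ such that (1) $\{0\}\in\mathcal L$; (2) $M^{\perp}\in\mathcal L$ for every $M\in\mathcal L$; (3) $M+\operatorname{span}\{u\}\in\mathcal L$ for all $M\in\mathcal L$, $u\in S$. Order $\mathcal L$ by inclusion. In a poset $P$, a net $(x_\gamma)$ \emph{o-converges} to $x$ if there are an increasing net $(a_\gamma)$ with supremum $x$ and a decreasing net $(b_\gamma)$ with infimum $x$, over the same index set, such that $a_\gamma\le x_\gamma\le b_\gamma$ for all $\gamma$. A set $X\subseteq P$ is \emph{o-closed} if no net in $X$ o-converges to a point outside $X$; the o-closed sets are the closed sets of the \emph{order topology} $\tau_o(P)$. A map between posets is \emph{o-continuous} if it preserves o-convergence of nets. A \emph{state} on $(S,\mathcal L)$ is a function $s:\mathcal L\to[0,1]$ with $s(S)=1$ and $s(A\vee B)=s(A)+s(B)$ whenever $A,B\in\mathcal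 L$, $A\perp B$, and the supremum $A\vee B$ exists in $\mathcal L$. The \emph{orthogonal dimension} $\dim S$ is the common cardinality of all maximal orthonormal systems of $S$. \textbf{Theorem.} Let $(S,\mathcal L)$ be a pre-Hilbert space logic with $\dim S=\aleph_0$. The following are equivalent: (i) $\tau_o(\mathcal L)$ is a Hausdorff topology; (ii) $S$ is complete, i.e. a Hilbert space; (iii) there is an o-continuous state on $(S,\mathcal L)$. Moreover, the implications (ii)$\Rightarrow$(iii) and (iii)$\Rightarrow$(i) hold for every pre-Hilbert space logic $(S,\mathcal L)$ with $S\neq\{0\}$, without any assumption on $\dim S$. -/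

import Mathlib

universe u v

/-- A net `x : Γ → P` (with `Γ` a directed set) o-converges to `p` if it is squeezed between an
increasing net with supremum `p` and a decreasing net with infimum `p`. -/
def OConverges {P : Type*} [PartialOrder P] {Γ : Type*} [Preorder Γ] (x : Γ → P) (p : P) : Prop :=
  ∃ a b : Γ → P, Monotone a ∧ Antitone b ∧ (∀ γ, a γ ≤ x γ ∧ x γ ≤ b γ) ∧
    IsLUB (Set.range a) p ∧ IsGLB (Set.range b) p

/-- A set is o-closed if no net in it o-converges to a point outside of it. Index sets in the
universe of `P` suffice: a net together with its squeezing nets can be re-indexed by a set of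
triples of elements of `P`. -/
def OClosed {P : Type u} [PartialOrder P] (X : Set P) : Prop :=
  ∀ (Γ : Type u) [Preorder Γ] [IsDirectedOrder Γ] [Nonempty Γ] (x : Γ → P) (p : P),
    (∀ γ, x γ ∈ X) → OConverges x p → p ∈ X

theorem OClosed.empty {P : Type*} [PartialOrder P] : OClosed (∅ : Set P) := by
  intro Γ _ _ _ x p hx _
  exact (hx (Classical.arbitrary Γ)).elim

theorem OClosed.sInter {P : Type*} [PartialOrder P] {A : Set (Set P)} (hA : ∀ X ∈ A, OClosed X) :
    OClosed (⋂₀ A) := by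
  intro Γ _ _ _ x p hx hp X hX
  exact hA X hX Γ x p (fun γ => hx γ X hX) hp

/-- If a net is cofinally in the o-closed set `X`, then its o-limit is in `X`. -/
theorem OClosed.mem_of_cofinal {P : Type u} [PartialOrder P] {X : Set P} (hX : OClosed X)
    {Γ : Type u} [Preorder Γ] [IsDirectedOrder Γ] [Nonempty Γ] {x : Γ → P} {p : P}
    (hp : OConverges x p) (hc : ∀ γ, ∃ δ, γ ≤ δ ∧ x δ ∈ X) : p ∈ X := by
  obtain ⟨a, b, ha, hb, hab, hla, hgb⟩ := hp
  have : Nonempty {γ : Γ // x γ ∈ X} := by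
    obtain ⟨δ, _, hδ⟩ := hc (Classical.arbitrary Γ)
    exact ⟨⟨δ, hδ⟩⟩
  have : IsDirectedOrder {γ : Γ // x γ ∈ X} := by
    refine ⟨fun s t => ?_⟩
    obtain ⟨u, hsu, htu⟩ := exists_ge_ge s.1 t.1
    obtain ⟨δ, hδ, hδX⟩ := hc u
    exact ⟨⟨δ, hδX⟩, hsu.trans hδ, htu.trans hδ⟩
  refine hX {γ : Γ // x γ ∈ X} (fun γ => x γ.1) p (fun γ => γ.2)
    ⟨fun γ => a γ.1, fun γ => b γ.1, fun _ _ h => ha h, fun _ _ h => hb h, fun γ => hab γ.1,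
      ⟨?_, ?_⟩, ⟨?_, ?_⟩⟩
  · rintro _ ⟨γ, rfl⟩
    exact hla.1 ⟨γ.1, rfl⟩
  · intro q hq
    refine hla.2 ?_
    rintro _ ⟨γ, rfl⟩
    obtain ⟨δ, hδ, hδX⟩ := hc γ
    exact (ha hδ).trans (hq ⟨⟨δ, hδX⟩, rfl⟩)
  · rintro _ ⟨γ, rfl⟩
    exact hgb.1 ⟨γ.1, rfl⟩
  · intro q hq
    refine hgb.2 ?_
    rintro _ ⟨γ, rfl⟩
    obtain ⟨δ, hδ, hδX⟩ := hc γ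
    exact (hq ⟨⟨δ, hδX⟩, rfl⟩ : q ≤ b δ).trans (hb hδ)

theorem OClosed.union {P : Type*} [PartialOrder P] {X Y : Set P} (hX : OClosed X)
    (hY : OClosed Y) : OClosed (X ∪ Y) := by
  intro Γ _ _ _ x p hx hp
  by_cases hc : ∀ γ, ∃ δ, γ ≤ δ ∧ x δ ∈ X
  · exact Or.inl (hX.mem_of_cofinal hp hc)
  · right
    push Not at hc
    obtain ⟨γ₀, h₀⟩ := hc
    refine hY.mem_of_cofinal hp fun γ => ?_
    obtain ⟨δ, h₁, h₂⟩ := exists_ge_ge γ γ₀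
    exact ⟨δ, h₁, (hx δ).resolve_left (h₀ δ h₂)⟩

/-- The order topology `τ_o(P)` of a poset: its closed sets are the o-closed sets. (This is not
the topology of Mathlib's class `OrderTopology`.) -/
@[reducible]
def oTopology (P : Type*) [PartialOrder P] : TopologicalSpace P :=
  TopologicalSpace.ofClosed {X : Set P | OClosed X} OClosed.empty
    (fun _ hA => OClosed.sInter hA) (fun _ hX _ hY => OClosed.union hX hY)

/-- A map between posets is o-continuous if it preserves o-convergence of nets. -/
def OContinuous {P : Type u} {Q : Type v} [PartialOrder P] [PartialOrder Q] (f : P → Q) : Prop :=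
  ∀ (Γ : Type u) [Preorder Γ] [IsDirectedOrder Γ] [Nonempty Γ] (x : Γ → P) (p : P),
    OConverges x p → OConverges (fun γ => f (x γ)) (f p)

/-- A set of orthonormal vectors is a maximal orthonormal system of `S` if only the zero vector
is orthogonal to all of its members. -/
def IsMONS (𝕜 : Type*) {S : Type*} [RCLike 𝕜] [NormedAddCommGroup S] [InnerProductSpace 𝕜 S]
    (A : Set S) : Prop :=
  Orthonormal 𝕜 (fun a : A => (a : S)) ∧ ∀ x : S, (∀ a ∈ A, inner 𝕜 a x = 0) → x = 0

/-- The orthogonal dimension of `S`: the cardinality of the maximal orthonormal systems of `S`.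
Such systems exist and all have the same cardinality (`exists_isMONS`, `IsMONS.mk_eq_orthogonalDim`). -/
noncomputable def orthogonalDim (𝕜 : Type*) (S : Type*) [RCLike 𝕜] [NormedAddCommGroup S]
    [InnerProductSpace 𝕜 S] : Cardinal :=
  sInf {c | ∃ A : Set S, IsMONS 𝕜 A ∧ Cardinal.mk A = c}

theorem exists_isMONS (𝕜 : Type*) (S : Type*) [RCLike 𝕜] [NormedAddCommGroup S]
    [InnerProductSpace 𝕜 S] : ∃ A : Set S, IsMONS 𝕜 A := by
  have h0 : Orthonormal 𝕜 (fun a : (∅ : Set S) => (a : S)) :=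
    ⟨fun a => a.2.elim, fun a => a.2.elim⟩
  obtain ⟨w, -, hw, hmax⟩ := exists_maximal_orthonormal h0
  refine ⟨w, hw, fun x hx => ?_⟩
  have h := (maximal_orthonormal_iff_orthogonalComplement_eq_bot hw).1 hmax
  have hxm : x ∈ (Submodule.span 𝕜 w)ᗮ := by
    rw [Submodule.mem_orthogonal]
    intro y hy
    induction hy using Submodule.span_induction with
    | mem y hy => exact hx y hy
    | zero => simp
    | add y z _ _ hy hz => rw [inner_add_left, hy, hz, add_zero]
    | smul c y _ hy => rw [inner_smul_left, hy, mul_zero]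
  rwa [h, Submodule.mem_bot] at hxm

theorem IsMONS.mk_le {𝕜 : Type*} {S : Type*} [RCLike 𝕜] [NormedAddCommGroup S]
    [InnerProductSpace 𝕜 S] {A B : Set S} (hA : IsMONS 𝕜 A) (hB : IsMONS 𝕜 B) :
    Cardinal.mk A ≤ Cardinal.mk B := by
  rcases B.finite_or_infinite with hf | hi
  · have : Finite B := hf
    have hfd : FiniteDimensional 𝕜 (Submodule.span 𝕜 B) := FiniteDimensional.span_of_finite 𝕜 hf
    have htop : Submodule.span 𝕜 B = ⊤ := by
      rw [← Submodule.orthogonal_eq_bot_iff, eq_bot_iff]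
      intro x hx
      refine hB.2 x fun b hb => ?_
      exact (Submodule.mem_orthogonal _ _).1 hx b (Submodule.subset_span hb)
    calc Cardinal.mk A ≤ Module.rank 𝕜 S := hA.1.linearIndependent.cardinal_le_rank
      _ = Module.rank 𝕜 (Submodule.span 𝕜 B) := by rw [htop, rank_top]
      _ ≤ Cardinal.mk B := rank_span_le B
  · have hcov : A ⊆ ⋃ b : B, {a | a ∈ A ∧ inner 𝕜 (b : S) a ≠ 0} := by
      intro a ha
      by_contra hn
      simp only [Set.mem_iUnion, Set.mem_ofPred_eq, not_exists, not_and, not_not] at hn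
      have : a = 0 := hB.2 a fun b hb => hn ⟨b, hb⟩ ha
      have h1 := hA.1.1 ⟨a, ha⟩
      simp [this] at h1
    have hcount : ∀ b : B, Cardinal.mk {a | a ∈ A ∧ inner 𝕜 (b : S) a ≠ 0} ≤ Cardinal.aleph0 := by
      intro b
      rw [Cardinal.le_aleph0_iff_set_countable]
      have hs := (hA.1.inner_products_summable (x := (b : S))).countable_support
      refine (hs.image (fun a : A => (a : S))).mono ?_
      rintro a ⟨ha, hne⟩
      refine ⟨⟨a, ha⟩, ?_, rfl⟩
      rw [Function.mem_support]
      exact pow_ne_zero 2 (norm_ne_zero_iff.2 fun h => hne (inner_eq_zero_symm.1 h))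
    have hBi : Cardinal.aleph0 ≤ Cardinal.mk B := Cardinal.infinite_iff.1 hi.to_subtype
    calc Cardinal.mk A ≤ Cardinal.mk (⋃ b : B, {a | a ∈ A ∧ inner 𝕜 (b : S) a ≠ 0}) :=
          Cardinal.mk_le_mk_of_subset hcov
      _ ≤ Cardinal.sum fun b : B => Cardinal.mk {a | a ∈ A ∧ inner 𝕜 (b : S) a ≠ 0} :=
          Cardinal.mk_iUnion_le_sum_mk
      _ ≤ Cardinal.sum fun _ : B => Cardinal.aleph0 := Cardinal.sum_le_sum _ _ hcount
      _ = Cardinal.mk B := by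
          rw [Cardinal.sum_const', Cardinal.mul_aleph0_eq hBi]

theorem IsMONS.mk_eq_orthogonalDim {𝕜 : Type*} {S : Type*} [RCLike 𝕜] [NormedAddCommGroup S]
    [InnerProductSpace 𝕜 S] {A : Set S} (hA : IsMONS 𝕜 A) :
    Cardinal.mk A = orthogonalDim 𝕜 S := by
  obtain ⟨B, hB, hc⟩ := csInf_mem (s := {c | ∃ A : Set S, IsMONS 𝕜 A ∧ Cardinal.mk A = c})
    ⟨_, A, hA, rfl⟩
  exact (le_antisymm (hA.mk_le hB) (hB.mk_le hA)).trans hc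

/-- A pre-Hilbert space logic on `S`: a family of orthogonally closed linear subspaces that
contains `{0}` and is closed under orthocomplements and one-dimensional perturbations. -/
structure PreHilbertSpaceLogic (𝕜 : Type*) (S : Type*) [RCLike 𝕜] [NormedAddCommGroup S]
    [InnerProductSpace 𝕜 S] where
  carrier : Set (Submodule 𝕜 S)
  orthogonally_closed : ∀ M ∈ carrier, Mᗮᗮ = M
  bot_mem : ⊥ ∈ carrier
  orthogonal_mem : ∀ M ∈ carrier, Mᗮ ∈ carrier
  sup_span_mem : ∀ M ∈ carrier, ∀ u : S, M ⊔ Submodule.span 𝕜 {u} ∈ carrier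

namespace PreHilbertSpaceLogic

/-- The members of the logic, as a poset under inclusion. -/
abbrev Elem {𝕜 : Type*} {S : Type*} [RCLike 𝕜] [NormedAddCommGroup S] [InnerProductSpace 𝕜 S]
    (L : PreHilbertSpaceLogic 𝕜 S) : Type _ :=
  {M : Submodule 𝕜 S // M ∈ L.carrier}

theorem top_mem {𝕜 : Type*} {S : Type*} [RCLike 𝕜] [NormedAddCommGroup S]
    [InnerProductSpace 𝕜 S] (L : PreHilbertSpaceLogic 𝕜 S) : ⊤ ∈ L.carrier := by
  have h := L.orthogonal_mem ⊥ L.bot_mem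
  rwa [Submodule.bot_orthogonal_eq_top] at h

/-- A state: a normalized function into `[0,1]` that is additive on those pairs of orthogonal
members whose join exists in the logic. -/
structure IsState {𝕜 : Type*} {S : Type*} [RCLike 𝕜] [NormedAddCommGroup S]
    [InnerProductSpace 𝕜 S] (L : PreHilbertSpaceLogic 𝕜 S)
    (s : L.Elem → Set.Icc (0 : ℝ) 1) : Prop where
  top_eq_one : (s ⟨⊤, L.top_mem⟩ : ℝ) = 1
  additive : ∀ A B C : L.Elem, A.1 ⟂ B.1 → IsLUB {A, B} C → (s C : ℝ) = (s A : ℝ) + (s B : ℝ)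

end PreHilbertSpaceLogic

/-!
For complete `S` every unit vector `u` gives the state `M ↦ ‖P_M u‖ ^ 2`. It is o-continuous
because the projections onto an increasing net of closed subspaces converge strongly to the
projection onto the closure of their union. Being o-continuous, these states are continuous for
`τ_o`, and together they separate the points of the logic.

The converses rest on one feature of an incomplete `S`: for `v` in the completion but outside of
`S`, the vectors of `S` orthogonal to `v` form a hyperplane `N` with `Nᗮ = ⊥`. Hence the
orthocomplements of the finitely generated `F ≤ N` decrease to `⊥`, although each `Fᗮ` contains
vectors arbitrarily near `v`; the same holds relative to a finite-dimensional `G`. If `U` is an open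
neighbourhood of `⊥`, one can therefore enlarge any finite-dimensional `G` in `U` by a vector near
any prescribed `v` without leaving `U`. For countable dimension take a maximal orthonormal system
`(e j)` and let these vectors approximate each of `v` and `v + e j` ever more closely: the resulting
increasing sequence in `U` has supremum `⊤`, so `⊥` and `⊤` cannot be separated.

An o-continuous state `s` is small on `Fᗮ` for some such `F`. Suppose that `p ∈ F`, `y ∈ Fᗮ` and
`‖p‖` is small compared to `‖y‖`. Rotating in an additional dimension shows that, up to a multiple
of the bound on `Fᗮ`, the value of `s` at the line of `p + y` is at most half its value at the line
of `p + c • y` for some `c ≥ 1 / 4`. Iterating, `s` nearly vanishes at the line of `p + y`. For any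
`e ∈ S`, choosing `v` near `e` makes the projection of `e` onto `F` small, so `s` vanishes at every
line, hence at every finite-dimensional subspace, which contradicts `s F + s Fᗮ = 1`.
-/

open Filter Topology UniformSpace

theorem isClosed_oTopology_iff {P : Type*} [PartialOrder P] {X : Set P} :
    IsClosed[oTopology P] X ↔ OClosed X := by
  rw [← @isOpen_compl_iff _ _ (oTopology P)]
  change Xᶜᶜ ∈ {X : Set P | OClosed X} ↔ _
  rw [compl_compl]
  rfl

theorem OConverges.of_monotone {P : Type*} [PartialOrder P] {Γ : Type*} [Preorder Γ] [Nonempty Γ]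
    {x : Γ → P} {p : P} (hx : Monotone x) (hp : IsLUB (Set.range x) p) : OConverges x p :=
  ⟨x, fun _ => p, hx, antitone_const, fun γ => ⟨le_rfl, hp.1 ⟨γ, rfl⟩⟩, hp,
    by simpa only [Set.range_const] using isGLB_singleton⟩

theorem OConverges.of_le_antitone {P : Type*} [PartialOrder P] {Γ : Type*} [Preorder Γ]
    [Nonempty Γ] {x b : Γ → P} {p : P} (hb : Antitone b) (hp : IsGLB (Set.range b) p)
    (hpx : ∀ γ, p ≤ x γ) (hxb : ∀ γ, x γ ≤ b γ) : OConverges x p :=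
  ⟨fun _ => p, b, monotone_const, hb, fun γ => ⟨hpx γ, hxb γ⟩,
    by simpa only [Set.range_const] using isLUB_singleton, hp⟩

theorem OConverges.tendsto {P : Type*} [LinearOrder P] [TopologicalSpace P] [OrderTopology P]
    {Γ : Type*} [Preorder Γ] {x : Γ → P} {p : P} (h : OConverges x p) : Tendsto x atTop (𝓝 p) := by
  obtain ⟨a, b, ha, hb, hab, hla, hgb⟩ := h
  exact tendsto_of_tendsto_of_tendsto_of_le_of_le (tendsto_atTop_isLUB ha hla)
    (tendsto_atTop_isGLB hb hgb) (fun γ => (hab γ).1) (fun γ => (hab γ).2)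

theorem OClosed.mem_of_isLUB_range_nat {P : Type*} [PartialOrder P] {X : Set P} (hX : OClosed X)
    {x : ℕ → P} {p : P} (hx : Monotone x) (hxX : ∀ n, x n ∈ X) (hp : IsLUB (Set.range x) p) :
    p ∈ X :=
  hX (ULift ℕ) (x ∘ ULift.down) p (fun n => hxX n.down)
    (.of_monotone (hx.comp fun _ _ h => h) (by rwa [ULift.down_surjective.range_comp]))

theorem OContinuous.of_monotone {P : Type u} {Q : Type v} [PartialOrder P] [PartialOrder Q]
    {f : P → Q} (hf : Monotone f)
    (hsup : ∀ (Γ : Type u) [Preorder Γ] [IsDirectedOrder Γ] [Nonempty Γ] (a : Γ → P) (p : P),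
      Monotone a → IsLUB (Set.range a) p → IsLUB (Set.range (f ∘ a)) (f p))
    (hinf : ∀ (Γ : Type u) [Preorder Γ] [IsDirectedOrder Γ] [Nonempty Γ] (b : Γ → P) (p : P),
      Antitone b → IsGLB (Set.range b) p → IsGLB (Set.range (f ∘ b)) (f p)) :
    OContinuous f := by
  rintro Γ _ _ _ x p ⟨a, b, ha, hb, hab, hla, hgb⟩
  exact ⟨f ∘ a, f ∘ b, hf.comp ha, hf.comp_antitone hb, fun γ => ⟨hf (hab γ).1, hf (hab γ).2⟩,
    hsup Γ a p ha hla, hinf Γ b p hb hgb⟩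

theorem OContinuous.continuous {P : Type u} {Q : Type v} [PartialOrder P] [LinearOrder Q]
    [TopologicalSpace Q] [OrderTopology Q] {f : P → Q} (hf : OContinuous f) :
    @Continuous _ _ (oTopology P) _ f := by
  let := oTopology P
  refine continuous_iff_isClosed.2 fun C hC => isClosed_oTopology_iff.2 ?_
  intro Γ _ _ _ x p hx hp
  exact hC.mem_of_tendsto (hf Γ x p hp).tendsto (Eventually.of_forall hx)

theorem t2Space_oTopology_of_oContinuous_separating {P : Type u} (Q : Type v) [PartialOrder P]
    [LinearOrder Q] [TopologicalSpace Q] [OrderTopology Q]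
    (h : ∀ p q : P, (∀ f : P → Q, OContinuous f → f p = f q) → p = q) :
    @T2Space P (oTopology P) := by
  let := oTopology P
  refine ⟨fun p q hpq => ?_⟩
  obtain ⟨f, hf, hne⟩ : ∃ f : P → Q, OContinuous f ∧ f p ≠ f q := by
    by_contra! hc
    exact hpq (h p q hc)
  exact separated_by_continuous hf.continuous hne

section InnerProductSpace

variable {𝕜 : Type*} [RCLike 𝕜] {S : Type*} [NormedAddCommGroup S] [InnerProductSpace 𝕜 S]

theorem orthogonal_inf_orthogonal_singleton (A : Submodule 𝕜 S) (v : S) :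
    (A ⊓ (𝕜 ∙ v)ᗮ)ᗮ = Aᗮ ⊔ 𝕜 ∙ v := by
  refine le_antisymm (fun y hy => ?_) (sup_le (Submodule.orthogonal_le inf_le_left)
    ((Submodule.le_orthogonal_orthogonal _).trans (Submodule.orthogonal_le inf_le_right)))
  have hker : ⨅ _ : Unit, ((innerₛₗ 𝕜 v).domRestrict A).ker ≤
      ((innerₛₗ 𝕜 y).domRestrict A).ker := by
    rw [ciInf_const]
    exact fun a ha => (Submodule.mem_orthogonal' _ _).1 hy a
      ⟨a.2, Submodule.mem_orthogonal_singleton_iff_inner_right.2 ha⟩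
  obtain ⟨c, hc⟩ : ∃ c : 𝕜, c • (innerₛₗ 𝕜 v).domRestrict A = (innerₛₗ 𝕜 y).domRestrict A := by
    simpa only [Set.range_const, Submodule.mem_span_singleton] using
      mem_span_of_iInf_ker_le_ker hker
  refine Submodule.mem_sup.2 ⟨y - starRingEnd 𝕜 c • v, (Submodule.mem_orthogonal' _ _).2
    fun a ha => ?_, _, Submodule.smul_mem _ _ (Submodule.mem_span_singleton_self v),
    sub_add_cancel _ _⟩
  have hca : c * inner 𝕜 v a = inner 𝕜 y a := DFunLike.congr_fun hc ⟨a, ha⟩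
  rw [inner_sub_left, inner_smul_left, RCLike.conj_conj, hca, sub_self]

theorem orthogonal_inf_orthogonal_of_fg (A : Submodule 𝕜 S) {K : Submodule 𝕜 S} (hK : K.FG) :
    (A ⊓ Kᗮ)ᗮ = Aᗮ ⊔ K := by
  induction K, hK using Submodule.fg_induction generalizing A with
  | singleton v => exact orthogonal_inf_orthogonal_singleton A v
  | sup K₁ K₂ _ _ ih₁ ih₂ =>
    rw [← Submodule.inf_orthogonal, ← inf_assoc, ih₂, ih₁, sup_assoc]

theorem exists_mem_orthogonal_norm_eq (hS : ¬ FiniteDimensional 𝕜 S) {K : Submodule 𝕜 S}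
    (hK : K.FG) {r : ℝ} (hr : 0 ≤ r) : ∃ q ∈ Kᗮ, ‖q‖ = r := by
  have : FiniteDimensional 𝕜 K := Module.Finite.iff_fg.2 hK
  have hne : Kᗮ ≠ ⊥ := by
    rw [Ne, Submodule.orthogonal_eq_bot_iff]
    rintro rfl
    exact hS (Module.finite_def.2 hK)
  obtain ⟨y, hy, hy0⟩ := Submodule.exists_mem_ne_zero_of_ne_bot hne
  exact ⟨_, Submodule.smul_mem _ _ hy, norm_smul_inv_norm' hr hy0⟩

theorem sup_span_singleton_sub_starProjection (K : Submodule 𝕜 S) [K.HasOrthogonalProjection]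
    (x : S) : K ⊔ 𝕜 ∙ (x - K.starProjection x) = K ⊔ 𝕜 ∙ x := by
  have hP : K.starProjection x ∈ K := K.starProjection_apply_mem x
  refine le_antisymm (sup_le le_sup_left ?_) (sup_le le_sup_left ?_) <;>
    rw [Submodule.span_singleton_le_iff_mem]
  · exact sub_mem (Submodule.mem_sup_right (Submodule.mem_span_singleton_self x))
      (Submodule.mem_sup_left hP)
  · simpa only [add_sub_cancel] using
      Submodule.add_mem_sup hP (Submodule.mem_span_singleton_self (x - K.starProjection x))

end InnerProductSpace

section DenseEmbedding

variable {𝕜 : Type*} [RCLike 𝕜] {S : Type*} [NormedAddCommGroup S] [InnerProductSpace 𝕜 S]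
  {H : Type*} [NormedAddCommGroup H] [InnerProductSpace 𝕜 H] (ι : S →ₗᵢ[𝕜] H)

/-- The trace on `S` of the hyperplane of `H` orthogonal to `v`, where `S` is viewed as a subspace
of `H` along `ι`. For a dense `S` and `v` outside of it, this is a closed hyperplane of `S` whose
orthocomplement in `S` is trivial. -/
def hyperplaneTrace (v : H) : Submodule 𝕜 S :=
  (𝕜 ∙ v)ᗮ.comap ι.toLinearMap

variable {ι} {v : H}

theorem mem_hyperplaneTrace {z : S} : z ∈ hyperplaneTrace ι v ↔ inner 𝕜 v (ι z) = 0 :=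
  Submodule.mem_orthogonal_singleton_iff_inner_right

theorem orthogonal_inf_hyperplaneTrace (hι : DenseRange ι) {G : Submodule 𝕜 S} (hG : G.FG)
    (hv : v ∉ Set.range ι) : (Gᗮ ⊓ hyperplaneTrace ι v)ᗮ = G := by
  refine le_antisymm (fun y hy => ?_)
    ((Submodule.le_orthogonal_orthogonal G).trans (Submodule.orthogonal_le inf_le_left))
  have hrange : (ι.toLinearMap.range)ᗮ = ⊥ := by
    refine (Submodule.eq_bot_iff _).2 fun w hw => hι.eq_zero_of_inner_left 𝕜 fun z => ?_
    exact (Submodule.mem_orthogonal' _ _).1 hw _ ⟨z, rfl⟩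
  have hιy : ι y ∈ G.map ι.toLinearMap ⊔ 𝕜 ∙ v := by
    rw [← bot_sup_eq (G.map ι.toLinearMap ⊔ 𝕜 ∙ v), ← hrange, ← orthogonal_inf_orthogonal_of_fg _
      ((hG.map _).sup (Submodule.fg_span_singleton v)), ← Submodule.inf_orthogonal]
    rintro _ ⟨⟨z, rfl⟩, hzG, hzv⟩
    refine (ι.inner_map_map z y).trans (hy z ⟨fun g hg => ?_, hzv⟩)
    exact (ι.inner_map_map g z).symm.trans (hzG _ ⟨g, hg, rfl⟩)
  obtain ⟨_, ⟨g, hg, rfl⟩, w, hw, hgw⟩ := Submodule.mem_sup.1 hιy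
  obtain ⟨c, rfl⟩ := Submodule.mem_span_singleton.1 hw
  replace hgw : c • v = ι (y - g) := by rw [map_sub, ← hgw]; exact (add_sub_cancel_left _ _).symm
  rcases eq_or_ne c 0 with rfl | hc
  · rw [zero_smul, eq_comm, map_eq_zero_iff ι ι.injective, sub_eq_zero] at hgw
    exact hgw ▸ hg
  · exact (hv ⟨c⁻¹ • (y - g), by rw [map_smul, ← hgw, inv_smul_smul₀ hc]⟩).elim

theorem norm_map_sub_sq_of_le_hyperplaneTrace {F : Submodule 𝕜 S} [F.HasOrthogonalProjection]
    (hF : F ≤ hyperplaneTrace ι v) (y : S) : ‖ι y - v‖ ^ 2 =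
      ‖F.starProjection y‖ ^ 2 + ‖ι (y - F.starProjection y) - v‖ ^ 2 := by
  have hP := F.starProjection_apply_mem y
  have horth : inner 𝕜 (ι (F.starProjection y)) (ι (y - F.starProjection y) - v) = 0 := by
    rw [inner_sub_right, ι.inner_map_map, F.sub_starProjection_mem_orthogonal y _ hP, zero_sub,
      neg_eq_zero]
    exact inner_eq_zero_symm.1 (mem_hyperplaneTrace.1 (hF hP))
  have hsplit : ι y - v = ι (F.starProjection y) + (ι (y - F.starProjection y) - v) := by
    rw [map_sub]
    abel
  rw [hsplit, sq, norm_add_sq_eq_norm_sq_add_norm_sq_of_inner_eq_zero _ _ horth, ι.norm_map,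
    ← sq, ← sq]

theorem norm_starProjection_le_of_le_hyperplaneTrace {F : Submodule 𝕜 S}
    [F.HasOrthogonalProjection] (hF : F ≤ hyperplaneTrace ι v) (y : S) :
    ‖F.starProjection y‖ ≤ ‖ι y - v‖ := by
  refine le_of_sq_le_sq ?_ (norm_nonneg _)
  rw [norm_map_sub_sq_of_le_hyperplaneTrace hF y]
  exact le_add_of_nonneg_right (sq_nonneg _)

theorem exists_mem_orthogonal_norm_map_sub_lt (hι : DenseRange ι) {F : Submodule 𝕜 S}
    [F.HasOrthogonalProjection] (hF : F ≤ hyperplaneTrace ι v) {ε : ℝ} (hε : 0 < ε) :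
    ∃ x ∈ Fᗮ, ‖ι x - v‖ < ε := by
  obtain ⟨y, hy⟩ := hι.exists_dist_lt v hε
  rw [dist_comm, dist_eq_norm] at hy
  refine ⟨y - F.starProjection y, F.sub_starProjection_mem_orthogonal y,
    (le_of_sq_le_sq ?_ (norm_nonneg _)).trans_lt hy⟩
  rw [norm_map_sub_sq_of_le_hyperplaneTrace hF y]
  exact le_add_of_nonneg_left (sq_nonneg _)

theorem exists_notMem_range_norm_sub_lt (hι : ¬ Function.Surjective ι) (w : H) {ε : ℝ}
    (hε : 0 < ε) : ∃ v ∉ Set.range ι, ‖v - w‖ < ε := by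
  have hdense : Dense (Set.range ι)ᶜ := by
    refine interior_eq_empty_iff_dense_compl.1 (Set.not_nonempty_iff_eq_empty.1 fun h => hι ?_)
    exact LinearMap.range_eq_top.1 (ι.toLinearMap.range.eq_top_of_nonempty_interior' h)
  obtain ⟨v, hv, hvw⟩ := hdense.exists_dist_lt w hε
  exact ⟨v, hv, by rwa [dist_comm, dist_eq_norm] at hvw⟩

end DenseEmbedding

theorem not_surjective_toComplₗᵢ {𝕜 : Type*} [RCLike 𝕜] {S : Type*} [NormedAddCommGroup S]
    [InnerProductSpace 𝕜 S] (hS : ¬ CompleteSpace S) :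
    ¬ Function.Surjective (Completion.toComplₗᵢ (𝕜 := 𝕜) (E := S)) := fun h =>
  hS (((Completion.isUniformInducing_coe S).completeSpace_congr h).2 inferInstance)

namespace PreHilbertSpaceLogic

variable {𝕜 : Type*} [RCLike 𝕜] {S : Type*} [NormedAddCommGroup S] [InnerProductSpace 𝕜 S]

section Basic

variable (L : PreHilbertSpaceLogic 𝕜 S)

theorem sup_fg_mem {M F : Submodule 𝕜 S} (hM : M ∈ L.carrier) (hF : F.FG) :
    M ⊔ F ∈ L.carrier := by
  induction F, hF using Submodule.fg_induction generalizing M with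
  | singleton u => exact L.sup_span_mem M hM u
  | sup F G _ _ hF hG =>
    rw [← sup_assoc]
    exact hG (hF hM)

theorem fg_mem {F : Submodule 𝕜 S} (hF : F.FG) : F ∈ L.carrier := by
  simpa only [bot_sup_eq] using L.sup_fg_mem L.bot_mem hF

theorem inf_orthogonal_mem {M F : Submodule 𝕜 S} (hM : M ∈ L.carrier) (hF : F.FG) :
    M ⊓ Fᗮ ∈ L.carrier := by
  have h := L.orthogonal_mem _ (L.sup_fg_mem (L.orthogonal_mem _ hM) hF)
  rwa [← Submodule.inf_orthogonal, L.orthogonally_closed M hM] at h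

variable {L}

instance : BoundedOrder L.Elem where
  top := ⟨⊤, L.top_mem⟩
  le_top M := (le_top : M.1 ≤ ⊤)
  bot := ⟨⊥, L.bot_mem⟩
  bot_le M := (bot_le : ⊥ ≤ M.1)

/-- The orthocomplementation of the logic. -/
def Elem.compl (M : L.Elem) : L.Elem :=
  ⟨M.1ᗮ, L.orthogonal_mem _ M.2⟩

theorem Elem.compl_antitone : Antitone (Elem.compl : L.Elem → L.Elem) :=
  fun _ _ h => Submodule.orthogonal_le h

theorem Elem.compl_compl (M : L.Elem) : M.compl.compl = M :=
  Subtype.ext (L.orthogonally_closed _ M.2)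

theorem Elem.compl_le_comm {A B : L.Elem} : A.compl ≤ B ↔ B.compl ≤ A :=
  ⟨fun h => A.compl_compl ▸ compl_antitone h, fun h => B.compl_compl ▸ compl_antitone h⟩

theorem Elem.isLUB_compl {T : Set L.Elem} {p : L.Elem} (h : IsGLB T p) :
    IsLUB (Elem.compl '' T) p.compl := by
  refine ⟨Set.forall_mem_image.2 fun M hM => compl_antitone (h.1 hM), fun q hq => ?_⟩
  exact Elem.compl_le_comm.2 (h.2 fun M hM => Elem.compl_le_comm.1 (hq ⟨M, hM, rfl⟩))

theorem isClosed_coe (M : L.Elem) : IsClosed (M.1 : Set S) := by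
  rw [← L.orthogonally_closed _ M.2]
  exact Submodule.isClosed_orthogonal _

theorem eq_zero_of_isLUB {T : Set L.Elem} {C : L.Elem} (hC : IsLUB T C) {x : S} (hx : x ∈ C.1)
    (hT : ∀ M ∈ T, x ∈ M.1ᗮ) : x = 0 := by
  have hN := L.inf_orthogonal_mem C.2 (Submodule.fg_span_singleton (R := 𝕜) x)
  have hle : C ≤ ⟨_, hN⟩ := hC.2 fun M hM => le_inf (show M.1 ≤ C.1 from hC.1 hM) fun m hm =>
    Submodule.mem_orthogonal_singleton_iff_inner_left.2 (hT M hM m hm)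
  exact inner_self_eq_zero.1 (Submodule.mem_orthogonal_singleton_iff_inner_left.1 (hle hx).2)

end Basic

section VectorState

variable [CompleteSpace S] {L : PreHilbertSpaceLogic 𝕜 S}

instance (M : L.Elem) : M.1.HasOrthogonalProjection :=
  have : CompleteSpace M.1 := (isClosed_coe M).completeSpace_coe
  inferInstance

theorem coe_eq_topologicalClosure_of_isLUB {T : Set L.Elem} {C : L.Elem} (hC : IsLUB T C) :
    C.1 = (⨆ M ∈ T, M.1).topologicalClosure := by
  set W := (⨆ M ∈ T, M.1).topologicalClosure
  have hWC : W ≤ C.1 :=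
    Submodule.topologicalClosure_minimal _ (iSup₂_le fun M hM => hC.1 hM) (isClosed_coe C)
  have hbot : Wᗮ ⊓ C.1 = ⊥ := by
    refine (Submodule.eq_bot_iff _).2 fun x hx => eq_zero_of_isLUB hC hx.2 fun M hM => ?_
    refine Submodule.orthogonal_le ?_ hx.1
    exact (le_iSup₂ (f := fun (M : L.Elem) (_ : M ∈ T) => M.1) M hM).trans
      (Submodule.le_topologicalClosure _)
  rw [← Submodule.sup_orthogonal_inf_of_hasOrthogonalProjection hWC, hbot, sup_bot_eq]

theorem starProjection_eq_add_of_isLUB {A B C : L.Elem} (hAB : A.1 ⟂ B.1) (hC : IsLUB {A, B} C)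
    (u : S) : C.1.starProjection u = A.1.starProjection u + B.1.starProjection u := by
  have hPA := A.1.starProjection_apply_mem u
  have hPB := B.1.starProjection_apply_mem u
  have horth : C.1ᗮ = A.1ᗮ ⊓ B.1ᗮ := by
    rw [coe_eq_topologicalClosure_of_isLUB hC, Submodule.orthogonal_closure, iSup_pair,
      Submodule.inf_orthogonal]
  refine Submodule.eq_starProjection_of_mem_orthogonal
    (add_mem (hC.1 (Set.mem_insert A {B}) hPA) (hC.1 (Set.mem_insert_of_mem A rfl) hPB)) ?_
  rw [horth]
  refine ⟨?_, ?_⟩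
  · rw [← sub_sub]
    exact sub_mem (A.1.sub_starProjection_mem_orthogonal u) (hAB.symm hPB)
  · rw [add_comm, ← sub_sub]
    exact sub_mem (B.1.sub_starProjection_mem_orthogonal u) (hAB hPA)

theorem tendsto_starProjection_of_isLUB {Γ : Type*} [Preorder Γ] {a : Γ → L.Elem}
    (ha : Monotone a) {p : L.Elem} (hp : IsLUB (Set.range a) p) (u : S) :
    Tendsto (fun γ => (a γ).1.starProjection u) atTop (𝓝 (p.1.starProjection u)) := by
  have hpW : p.1 = (⨆ γ, (a γ).1).topologicalClosure := by
    rw [coe_eq_topologicalClosure_of_isLUB hp, iSup_range]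
  simpa only [hpW] using Submodule.starProjection_tendsto_closure_iSup (fun γ => (a γ).1) ha u

/-- The state `M ↦ ‖P_M u‖²` given by a unit vector `u` of a Hilbert space. -/
noncomputable def vectorState (L : PreHilbertSpaceLogic 𝕜 S) (u : S) (hu : ‖u‖ = 1)
    (M : L.Elem) : Set.Icc (0 : ℝ) 1 :=
  ⟨‖M.1.starProjection u‖ ^ 2, sq_nonneg _,
    pow_le_one₀ (norm_nonneg _) (hu ▸ M.1.norm_starProjection_apply_le u)⟩

variable {u : S} {hu : ‖u‖ = 1}

theorem coe_vectorState (M : L.Elem) :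
    (vectorState L u hu M : ℝ) = ‖M.1.starProjection u‖ ^ 2 :=
  rfl

theorem coe_vectorState_compl (M : L.Elem) :
    (vectorState L u hu M.compl : ℝ) = 1 - vectorState L u hu M := by
  have h := M.1.norm_sq_eq_add_norm_sq_starProjection u
  rw [hu, one_pow] at h
  exact eq_sub_of_add_eq' h.symm

theorem isState_vectorState : L.IsState (vectorState L u hu) where
  top_eq_one := by
    rw [coe_vectorState, Submodule.starProjection_eq_self_iff.2 Submodule.mem_top, hu, one_pow]
  additive A B C hAB hC := by
    have horth := Submodule.isOrtho_iff_inner_eq.1 hAB _ (A.1.starProjection_apply_mem u) _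
      (B.1.starProjection_apply_mem u)
    simp only [coe_vectorState, starProjection_eq_add_of_isLUB hAB hC, sq,
      norm_add_sq_eq_norm_sq_add_norm_sq_of_inner_eq_zero _ _ horth]

theorem vectorState_mono : Monotone (vectorState L u hu) := by
  intro A B h
  refine pow_le_pow_left₀ (norm_nonneg _) ?_ 2
  rw [← Submodule.starProjection_comp_starProjection_of_le h]
  exact Submodule.norm_starProjection_apply_le _ _

theorem tendsto_vectorState_of_isLUB {Γ : Type*} [Preorder Γ] {a : Γ → L.Elem}
    (ha : Monotone a) {p : L.Elem} (hp : IsLUB (Set.range a) p) :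
    Tendsto (fun γ => (vectorState L u hu (a γ) : ℝ)) atTop (𝓝 (vectorState L u hu p)) :=
  (tendsto_starProjection_of_isLUB ha hp u).norm.pow 2

theorem tendsto_vectorState_of_isGLB {Γ : Type*} [Preorder Γ] {b : Γ → L.Elem}
    (hb : Antitone b) {p : L.Elem} (hp : IsGLB (Set.range b) p) :
    Tendsto (fun γ => (vectorState L u hu (b γ) : ℝ)) atTop (𝓝 (vectorState L u hu p)) := by
  have hlub : IsLUB (Set.range (Elem.compl ∘ b)) p.compl :=
    Set.range_comp Elem.compl b ▸ Elem.isLUB_compl hp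
  simpa only [Function.comp, coe_vectorState_compl, sub_sub_cancel] using
    (tendsto_vectorState_of_isLUB (hu := hu) (Elem.compl_antitone.comp hb) hlub).const_sub 1

theorem oContinuous_vectorState : OContinuous (vectorState L u hu) :=
  .of_monotone vectorState_mono
    (fun _ _ _ _ _ _ ha hp => isLUB_of_tendsto_atTop (vectorState_mono.comp ha)
      (tendsto_subtype_rng.2 (tendsto_vectorState_of_isLUB ha hp)))
    (fun _ _ _ _ _ _ hb hp => isGLB_of_tendsto_atTop (vectorState_mono.comp_antitone hb)
      (tendsto_subtype_rng.2 (tendsto_vectorState_of_isGLB hb hp)))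

theorem exists_oContinuous_state [Nontrivial S] (L : PreHilbertSpaceLogic 𝕜 S) :
    ∃ s : L.Elem → Set.Icc (0 : ℝ) 1, L.IsState s ∧ OContinuous s := by
  obtain ⟨x, hx⟩ := exists_ne (0 : S)
  exact ⟨vectorState L _ (norm_smul_inv_norm (𝕜 := 𝕜) hx), isState_vectorState,
    oContinuous_vectorState⟩

theorem le_of_forall_vectorState_eq {A B : L.Elem}
    (h : ∀ (u : S) (hu : ‖u‖ = 1), vectorState L u hu A = vectorState L u hu B) : A ≤ B := by
  intro x hxA
  rcases eq_or_ne x 0 with rfl | hx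
  · exact B.1.zero_mem
  have hu := norm_smul_inv_norm (𝕜 := 𝕜) hx
  have hc : (‖x‖ : 𝕜)⁻¹ ≠ 0 := inv_ne_zero (RCLike.ofReal_ne_zero.2 (norm_ne_zero_iff.2 hx))
  rw [← B.1.smul_mem_iff hc,
    B.1.mem_iff_norm_starProjection, ← sq_eq_sq₀ (norm_nonneg _) (norm_nonneg _),
    ← coe_vectorState (hu := hu), ← h, coe_vectorState,
    Submodule.starProjection_eq_self_iff.2 (A.1.smul_mem _ hxA)]

theorem t2Space_of_completeSpace (L : PreHilbertSpaceLogic 𝕜 S) :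
    @T2Space L.Elem (oTopology L.Elem) :=
  t2Space_oTopology_of_oContinuous_separating (Set.Icc (0 : ℝ) 1) fun _ _ h => le_antisymm
    (le_of_forall_vectorState_eq fun _ _ => h _ oContinuous_vectorState)
    (le_of_forall_vectorState_eq fun _ _ => (h _ oContinuous_vectorState).symm)

end VectorState

end PreHilbertSpaceLogic

section FGSub

variable {𝕜 : Type*} [RCLike 𝕜] {S : Type*} [NormedAddCommGroup S] [InnerProductSpace 𝕜 S]

/-- The finitely generated subspaces of `N`, directed by inclusion: the index set of the nets of
the proof. -/
abbrev FGSub (N : Submodule 𝕜 S) : Type _ :=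
  {F : Submodule 𝕜 S // F.FG ∧ F ≤ N}

instance (N : Submodule 𝕜 S) : Nonempty (FGSub N) :=
  ⟨⊥, Submodule.fg_bot, bot_le⟩

instance (N : Submodule 𝕜 S) : IsDirectedOrder (FGSub N) :=
  ⟨fun A B => ⟨⟨A.1 ⊔ B.1, A.2.1.sup B.2.1, sup_le A.2.2 B.2.2⟩, le_sup_left (a := A.1),
    le_sup_right (a := A.1)⟩⟩

namespace PreHilbertSpaceLogic

variable {L : PreHilbertSpaceLogic 𝕜 S}

/-- A finitely generated subspace, as a member of the logic. -/
def ofFG (L : PreHilbertSpaceLogic 𝕜 S) {F : Submodule 𝕜 S} (hF : F.FG) : L.Elem :=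
  ⟨F, L.fg_mem hF⟩

theorem isGLB_range_compl_ofFG {N : Submodule 𝕜 S} {G : L.Elem} (hG : Nᗮ = G.1) :
    IsGLB (Set.range fun F : FGSub N => (L.ofFG F.2.1).compl) G := by
  constructor
  · rintro _ ⟨F, rfl⟩
    exact hG.ge.trans (Submodule.orthogonal_le F.2.2)
  · refine fun M hM => show M.1 ≤ G.1 from hG ▸ fun y hy z hz => ?_
    have hMz : M.1 ≤ (𝕜 ∙ z)ᗮ := hM ⟨⟨𝕜 ∙ z, Submodule.fg_span_singleton z,
      (Submodule.span_singleton_le_iff_mem z N).2 hz⟩, rfl⟩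
    exact Submodule.mem_orthogonal_singleton_iff_inner_right.1 (hMz hy)

theorem oConverges_of_le_compl_ofFG {N : Submodule 𝕜 S} {G : L.Elem} (hG : Nᗮ = G.1)
    {M : FGSub N → L.Elem} (hGM : ∀ F, G ≤ M F) (hM : ∀ F, M F ≤ (L.ofFG F.2.1).compl) :
    OConverges M G :=
  .of_le_antitone (fun _ _ h => Submodule.orthogonal_le h) (isGLB_range_compl_ofFG hG) hGM hM

end PreHilbertSpaceLogic

end FGSub

section Hausdorff

variable {𝕜 : Type*} [RCLike 𝕜] {S : Type*} [NormedAddCommGroup S] [InnerProductSpace 𝕜 S]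
  {H : Type*} [NormedAddCommGroup H] [InnerProductSpace 𝕜 H] {ι : S →ₗᵢ[𝕜] H} {v : H}

theorem IsMONS.exists_total_seq_notMem_range {A : Set S} (hA : IsMONS 𝕜 A) (hAc : A.Countable)
    (hv : v ∉ Set.range ι) :
    ∃ t : ℕ → H, (∀ j, t j ∉ Set.range ι) ∧ ∀ y, (∀ j, inner 𝕜 (t j) (ι y) = 0) → y = 0 := by
  obtain ⟨e, he⟩ := (hAc.insert 0).exists_eq_range (Set.insert_nonempty 0 A)
  refine ⟨fun j => v + ι (e j), fun j ⟨z, hz⟩ => hv ⟨z - e j, ?_⟩, fun y hy => ?_⟩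
  · rw [map_sub, hz, add_sub_cancel_right]
  have hinner : ∀ a ∈ insert 0 A, inner 𝕜 v (ι y) + inner 𝕜 a y = 0 := by
    rw [he, Set.forall_mem_range]
    intro j
    rw [← ι.inner_map_map, ← inner_add_left, hy]
  have hvy : inner 𝕜 v (ι y) = 0 := by
    simpa only [inner_zero_left, add_zero] using hinner 0 (Set.mem_insert 0 A)
  exact hA.2 y fun a ha => by
    simpa only [hvy, zero_add] using hinner a (Set.mem_insert_of_mem 0 ha)

theorem inner_eq_zero_of_norm_sub_unpair_lt {x : ℕ → S} {t : ℕ → H}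
    (hx : ∀ n, ‖ι (x n) - t n.unpair.1‖ < 1 / ((n : ℝ) + 1)) {y : S}
    (hy : ∀ n, inner 𝕜 (x n) y = 0) (j : ℕ) : inner 𝕜 (t j) (ι y) = 0 := by
  have hpair : Tendsto (Nat.pair j) atTop atTop :=
    tendsto_atTop_mono (Nat.right_le_pair j) tendsto_id
  have hlim : Tendsto (fun i => ι (x (Nat.pair j i))) atTop (𝓝 (t j)) := by
    refine tendsto_iff_norm_sub_tendsto_zero.2 (squeeze_zero (fun _ => norm_nonneg _)
      (fun i => ?_) (tendsto_one_div_add_atTop_nhds_zero_nat.comp hpair))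
    simpa only [Nat.unpair_pair, Function.comp_apply] using (hx (Nat.pair j i)).le
  refine tendsto_nhds_unique (hlim.inner tendsto_const_nhds) ?_
  simp only [ι.inner_map_map, hy, tendsto_const_nhds]

namespace PreHilbertSpaceLogic

variable {L : PreHilbertSpaceLogic 𝕜 S}

theorem isLUB_top_of_forall_orthogonal {T : Set L.Elem}
    (h : ∀ y : S, (∀ M ∈ T, y ∈ M.1ᗮ) → y = 0) : IsLUB T ⊤ := by
  refine ⟨fun _ _ => le_top, fun C hC => ?_⟩
  have hbot : C.1ᗮ = ⊥ := (Submodule.eq_bot_iff _).2 fun y hy =>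
    h y fun M hM => Submodule.orthogonal_le (hC hM) hy
  change ⊤ ≤ C.1
  rw [← L.orthogonally_closed _ C.2, hbot, Submodule.bot_orthogonal_eq_top]

theorem exists_ofFG_sup_span_mem (hι : DenseRange ι) (hv : v ∉ Set.range ι) {U : Set L.Elem}
    (hU : OClosed Uᶜ) {G : Submodule 𝕜 S} (hG : G.FG) (hGU : L.ofFG hG ∈ U) {ε : ℝ}
    (hε : 0 < ε) :
    ∃ x : S, ‖ι x - v‖ < ε ∧ L.ofFG (hG.sup (Submodule.fg_span_singleton x)) ∈ U := by
  by_contra! hcon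
  have hnear : ∀ F : FGSub (Gᗮ ⊓ hyperplaneTrace ι v), ∃ x ∈ F.1ᗮ, ‖ι x - v‖ < ε := by
    intro F
    have : FiniteDimensional 𝕜 F.1 := Module.Finite.iff_fg.2 F.2.1
    exact exists_mem_orthogonal_norm_map_sub_lt hι (F.2.2.trans inf_le_right) hε
  choose x hxF hxv using hnear
  let M (F : FGSub (Gᗮ ⊓ hyperplaneTrace ι v)) : L.Elem :=
    L.ofFG (hG.sup (Submodule.fg_span_singleton (x F)))
  have hGM : ∀ F, L.ofFG hG ≤ M F := fun F => show G ≤ G ⊔ 𝕜 ∙ x F from le_sup_left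
  have hM : ∀ F, M F ≤ (L.ofFG F.2.1).compl := by
    refine fun F => show G ⊔ 𝕜 ∙ x F ≤ F.1ᗮ from sup_le ?_ ?_
    · exact (Submodule.le_orthogonal_orthogonal G).trans
        (Submodule.orthogonal_le (F.2.2.trans inf_le_left))
    · exact (Submodule.span_singleton_le_iff_mem _ _).2 (hxF F)
  have hN : (Gᗮ ⊓ hyperplaneTrace ι v)ᗮ = (L.ofFG hG).1 := orthogonal_inf_hyperplaneTrace hι hG hv
  have hconv : OConverges M (L.ofFG hG) := oConverges_of_le_compl_ofFG hN hGM hM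
  exact hU (FGSub (Gᗮ ⊓ hyperplaneTrace ι v)) M _ (fun F => hcon (x F) (hxv F)) hconv hGU

theorem exists_monotone_seq_mem (hι : DenseRange ι) {t : ℕ → H} (ht : ∀ n, t n ∉ Set.range ι)
    {U : Set L.Elem} (hU : OClosed Uᶜ) (hbot : ⊥ ∈ U) {ε : ℕ → ℝ} (hε : ∀ n, 0 < ε n) :
    ∃ (G : ℕ → L.Elem) (x : ℕ → S), Monotone G ∧ (∀ n, G n ∈ U) ∧ (∀ n, x n ∈ (G (n + 1)).1) ∧
      ∀ n, ‖ι (x n) - t n‖ < ε n := by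
  choose x hx hxU using fun (n : ℕ) (G : {G : Submodule 𝕜 S // ∃ hG : G.FG, L.ofFG hG ∈ U}) =>
    exists_ofFG_sup_span_mem hι (ht n) hU G.2.1 G.2.2 (hε n)
  let G : ℕ → {G : Submodule 𝕜 S // ∃ hG : G.FG, L.ofFG hG ∈ U} :=
    Nat.rec ⟨⊥, Submodule.fg_bot, hbot⟩ fun n G => ⟨G.1 ⊔ 𝕜 ∙ x n G, _, hxU n G⟩
  refine ⟨fun n => L.ofFG (G n).2.1, fun n => x n (G n), monotone_nat_of_le_succ fun n => ?_,
    fun n => (G n).2.2, fun n => ?_, fun n => hx n (G n)⟩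
  · exact le_sup_left (a := (G n).1)
  · exact Submodule.mem_sup_right (Submodule.mem_span_singleton_self _)

theorem top_mem_of_oClosed_of_subset (hι : DenseRange ι) (hv : v ∉ Set.range ι) {A : Set S}
    (hA : IsMONS 𝕜 A) (hAc : A.Countable) {U C : Set L.Elem} (hU : OClosed Uᶜ) (hC : OClosed C)
    (hUC : U ⊆ C) (hbot : ⊥ ∈ U) : ⊤ ∈ C := by
  obtain ⟨t, ht, htotal⟩ := hA.exists_total_seq_notMem_range hAc hv
  obtain ⟨G, x, hGmono, hGU, hxG, hxt⟩ := exists_monotone_seq_mem hι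
    (fun n => ht n.unpair.1) hU hbot (fun n => Nat.one_div_pos_of_nat (n := n))
  refine hC.mem_of_isLUB_range_nat hGmono (fun n => hUC (hGU n)) ?_
  refine isLUB_top_of_forall_orthogonal fun y hy => htotal y ?_
  exact inner_eq_zero_of_norm_sub_unpair_lt hxt fun n => hy _ ⟨n + 1, rfl⟩ _ (hxG n)

theorem completeSpace_of_t2Space (hdim : orthogonalDim 𝕜 S ≤ Cardinal.aleph0)
    (hT : @T2Space L.Elem (oTopology L.Elem)) : CompleteSpace S := by
  by_contra hS
  obtain ⟨A, hA⟩ := exists_isMONS 𝕜 S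
  obtain ⟨v, hv, -⟩ := exists_notMem_range_norm_sub_lt
    (not_surjective_toComplₗᵢ (𝕜 := 𝕜) hS) 0 one_pos
  have hne : (⊥ : L.Elem) ≠ ⊤ := fun h => by
    have : Subsingleton S := (Submodule.subsingleton_iff 𝕜).1
      (subsingleton_of_bot_eq_top (congrArg Subtype.val h))
    exact hS inferInstance
  let := oTopology L.Elem
  obtain ⟨U, V, hU, hV, hbU, htV, hUV⟩ := hT.t2 hne
  exact top_mem_of_oClosed_of_subset Completion.denseRange_coe hv hA
    (Cardinal.le_aleph0_iff_set_countable.1 (hA.mk_eq_orthogonalDim.trans_le hdim))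
    (isClosed_oTopology_iff.1 hU.isClosed_compl) (isClosed_oTopology_iff.1 hV.isClosed_compl)
    hUV.subset_compl_right hbU htV

end PreHilbertSpaceLogic

end Hausdorff

section State

theorem exists_mul_one_sub_two_mul_mul_eq {A B : ℝ} (hB : 0 ≤ B) (hBA : 8 * B ≤ A) :
    ∃ c : ℝ, 1 / 4 ≤ c ∧ c * (1 - 2 * c) * A = B := by
  have hivt := intermediate_value_Icc' (f := fun c : ℝ => c * (1 - 2 * c) * A)
    (by norm_num : (1 / 4 : ℝ) ≤ 1 / 2) (by fun_prop)
  obtain ⟨c, hc, hcB⟩ := hivt (show B ∈ _ from ⟨by linarith, by linarith⟩)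
  exact ⟨c, hc.1, hcB⟩

theorem inner_add_smul_smul_eq_norm_sq {𝕜 : Type*} [RCLike 𝕜] {S : Type*}
    [NormedAddCommGroup S] [InnerProductSpace 𝕜 S] {p y : S} (hpy : inner 𝕜 p y = 0) {c : ℝ}
    (hc : c * (1 - 2 * c) * ‖y‖ ^ 2 = ‖p‖ ^ 2) :
    inner 𝕜 (p + (c : 𝕜) • y) (((1 - c : ℝ) : 𝕜) • y) = (‖p + (c : 𝕜) • y‖ : 𝕜) ^ 2 := by
  have hnorm : ‖p + (c : 𝕜) • y‖ ^ 2 = ‖p‖ ^ 2 + c ^ 2 * ‖y‖ ^ 2 := by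
    rw [sq, norm_add_sq_eq_norm_sq_add_norm_sq_of_inner_eq_zero _ _
      (by rw [inner_smul_right, hpy, mul_zero] : inner 𝕜 p ((c : 𝕜) • y) = 0), norm_smul,
      RCLike.norm_ofReal, ← sq, ← sq, mul_pow, sq_abs]
  rw [← RCLike.ofReal_pow, hnorm, inner_add_left, inner_smul_left, inner_smul_right,
    inner_smul_right, hpy, inner_self_eq_norm_sq_to_K, RCLike.conj_ofReal]
  norm_cast
  linear_combination hc

namespace PreHilbertSpaceLogic

variable {𝕜 : Type*} [RCLike 𝕜] {S : Type*} [NormedAddCommGroup S] [InnerProductSpace 𝕜 S]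
  {L : PreHilbertSpaceLogic 𝕜 S}

/-- The line spanned by `x`, as a member of the logic; it is `⊥` for `x = 0`. -/
def line (L : PreHilbertSpaceLogic 𝕜 S) (x : S) : L.Elem :=
  L.ofFG (Submodule.fg_span_singleton x)

theorem line_le_iff {x : S} {M : L.Elem} : L.line x ≤ M ↔ x ∈ M.1 :=
  Submodule.span_singleton_le_iff_mem x M.1

namespace IsState

variable {s : L.Elem → Set.Icc (0 : ℝ) 1}

theorem apply_of_sup_eq (hs : L.IsState s) {A B C : L.Elem} (hAB : A.1 ⟂ B.1)
    (hC : A.1 ⊔ B.1 = C.1) : (s C : ℝ) = s A + s B :=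
  hs.additive A B C hAB (IsLUB.of_image (f := Subtype.val) Subtype.coe_le_coe
    (by simpa only [Set.image_pair, ← hC] using isLUB_pair))

theorem apply_bot (hs : L.IsState s) : (s ⊥ : ℝ) = 0 :=
  left_eq_add.1 (hs.apply_of_sup_eq (A := ⊥) (B := ⊥) (C := ⊥) Submodule.isOrtho_bot_left
    (sup_idem _))

theorem mono_of_fg (hs : L.IsState s) {A B : L.Elem} (hA : A.1.FG) (h : A ≤ B) :
    (s A : ℝ) ≤ s B := by
  have : FiniteDimensional 𝕜 A.1 := Module.Finite.iff_fg.2 hA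
  have hsup : A.1 ⊔ B.1 ⊓ A.1ᗮ = B.1 := by
    rw [inf_comm]
    exact Submodule.sup_orthogonal_inf_of_hasOrthogonalProjection h
  have hadd := hs.apply_of_sup_eq (A := A) (B := ⟨_, L.inf_orthogonal_mem B.2 hA⟩)
    ((Submodule.isOrtho_orthogonal_right A.1).mono_right inf_le_right) hsup
  exact hadd ▸ le_add_of_nonneg_right (s _).2.1

theorem apply_add_apply_compl (hs : L.IsState s) {A : L.Elem} (hA : A.1.FG) :
    (s A : ℝ) + s A.compl = 1 := by
  have : FiniteDimensional 𝕜 A.1 := Module.Finite.iff_fg.2 hA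
  have htop : A.1 ⊔ A.compl.1 = (⊤ : L.Elem).1 :=
    Submodule.sup_orthogonal_of_hasOrthogonalProjection
  exact (hs.apply_of_sup_eq (Submodule.isOrtho_orthogonal_right A.1) htop).symm.trans
    hs.top_eq_one

theorem apply_line_le (hs : L.IsState s) {M : L.Elem} {x : S} (hx : x ∈ M.1) :
    (s (L.line x) : ℝ) ≤ s M :=
  hs.mono_of_fg (Submodule.fg_span_singleton x) (line_le_iff.2 hx)

theorem apply_ofFG_sup_span (hs : L.IsState s) {F : Submodule 𝕜 S} (hF : F.FG) {x : S}
    (hx : x ∈ Fᗮ) :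
    (s (L.ofFG (hF.sup (Submodule.fg_span_singleton x))) : ℝ) = s (L.ofFG hF) + s (L.line x) :=
  hs.apply_of_sup_eq
    (Submodule.IsOrtho.symm ((Submodule.span_singleton_le_iff_mem x Fᗮ).2 hx)) rfl

theorem apply_ofFG_eq_zero (hs : L.IsState s) (h : ∀ x, (s (L.line x) : ℝ) = 0)
    {F : Submodule 𝕜 S} (hF : F.FG) : (s (L.ofFG hF) : ℝ) = 0 := by
  induction F, hF using Submodule.fg_sup_span_induction with
  | bot => exact hs.apply_bot
  | sup N x hN ih =>
    have : FiniteDimensional 𝕜 N := Module.Finite.iff_fg.2 hN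
    have hadd := hs.apply_ofFG_sup_span hN (N.sub_starProjection_mem_orthogonal x)
    rw [ih, h, add_zero] at hadd
    simpa only [sup_span_singleton_sub_starProjection] using hadd

theorem apply_line_add_apply_line (hs : L.IsState s) {x y : S} (hxy : inner 𝕜 x y = 0) :
    (s (L.line x) : ℝ) + s (L.line y) = s (L.ofFG
      ((Submodule.fg_span_singleton (R := 𝕜) x).sup (Submodule.fg_span_singleton y))) :=
  (hs.apply_ofFG_sup_span _ (Submodule.mem_orthogonal_singleton_iff_inner_right.2 hxy)).symm

theorem apply_line_add_apply_line_le (hs : L.IsState s) {x y x' y' : S}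
    (hxy : inner 𝕜 x y = 0) (hxy' : inner 𝕜 x' y' = 0) (hx : x ∈ 𝕜 ∙ x' ⊔ 𝕜 ∙ y')
    (hy : y ∈ 𝕜 ∙ x' ⊔ 𝕜 ∙ y') :
    (s (L.line x) : ℝ) + s (L.line y) ≤ s (L.line x') + s (L.line y') := by
  rw [hs.apply_line_add_apply_line hxy, hs.apply_line_add_apply_line hxy']
  refine hs.mono_of_fg ((Submodule.fg_span_singleton x).sup (Submodule.fg_span_singleton y)) ?_
  exact sup_le ((Submodule.span_singleton_le_iff_mem _ _).2 hx)
    ((Submodule.span_singleton_le_iff_mem _ _).2 hy)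

theorem apply_line_add_le (hs : L.IsState s) {x y : S} (hxy : inner 𝕜 x y = 0) :
    (s (L.line (x + y)) : ℝ) ≤ s (L.line x) + s (L.line y) := by
  rw [hs.apply_line_add_apply_line hxy]
  exact hs.apply_line_le (Submodule.add_mem_sup (Submodule.mem_span_singleton_self x)
    (Submodule.mem_span_singleton_self y))

theorem apply_line_add_le_of_norm_eq (hs : L.IsState s) {x z q : S} (hxq : inner 𝕜 x q = 0)
    (hqz : inner 𝕜 q z = 0) (hxz : inner 𝕜 x z = (‖x‖ : 𝕜) ^ 2) (hq : ‖q‖ = ‖x‖) :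
    (s (L.line (x + z)) : ℝ) ≤ s (L.line (x + q)) + s (L.line (z - q)) := by
  rw [← add_add_sub_cancel x z q]
  refine hs.apply_line_add_le ?_
  rw [inner_add_left, inner_sub_right, inner_sub_right, hxz, hxq, hqz,
    inner_self_eq_norm_sq_to_K, hq]
  ring

-- The vector `x + z` is both `(x + q) + (z - q)` and `(x - q) + (z + q)`, two orthogonal sums, and
-- the orthogonal vectors `x + q` and `x - q` share the plane of `x` and `q`.
theorem two_mul_apply_line_add_le (hs : L.IsState s) {x z q : S} (hxq : inner 𝕜 x q = 0)
    (hqz : inner 𝕜 q z = 0) (hxz : inner 𝕜 x z = (‖x‖ : 𝕜) ^ 2) (hq : ‖q‖ = ‖x‖) :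
    2 * (s (L.line (x + z)) : ℝ) ≤
      s (L.line x) + s (L.line q) + s (L.line (z - q)) + s (L.line (z + q)) := by
  have hplus := hs.apply_line_add_le_of_norm_eq hxq hqz hxz hq
  have hminus : (s (L.line (x + z)) : ℝ) ≤ s (L.line (x - q)) + s (L.line (z + q)) := by
    simpa only [← sub_eq_add_neg, sub_neg_eq_add] using hs.apply_line_add_le_of_norm_eq (q := -q)
      (by rw [inner_neg_right, hxq, neg_zero]) (by rw [inner_neg_left, hqz, neg_zero]) hxz
      ((norm_neg q).trans hq)
  have horth : inner 𝕜 (x + q) (x - q) = 0 := by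
    rw [inner_add_left, inner_sub_right, inner_sub_right, hxq, inner_eq_zero_symm.1 hxq,
      inner_self_eq_norm_sq_to_K, inner_self_eq_norm_sq_to_K, hq]
    ring
  have hx : x ∈ 𝕜 ∙ x ⊔ 𝕜 ∙ q := Submodule.mem_sup_left (Submodule.mem_span_singleton_self x)
  have hq : q ∈ 𝕜 ∙ x ⊔ 𝕜 ∙ q := Submodule.mem_sup_right (Submodule.mem_span_singleton_self q)
  have hplane := hs.apply_line_add_apply_line_le horth hxq (add_mem hx hq) (sub_mem hx hq)
  linarith

theorem exists_two_mul_apply_line_add_le (hs : L.IsState s) (hS : ¬ FiniteDimensional 𝕜 S)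
    {F : Submodule 𝕜 S} (hF : F.FG) {ε : ℝ} (hε : ∀ z ∈ Fᗮ, (s (L.line z) : ℝ) ≤ ε) {p y : S}
    (hp : p ∈ F) (hy : y ∈ Fᗮ) (hpy : 8 * ‖p‖ ^ 2 ≤ ‖y‖ ^ 2) :
    ∃ c : ℝ, 1 / 4 ≤ c ∧
      2 * (s (L.line (p + y)) : ℝ) ≤ s (L.line (p + (c : 𝕜) • y)) + 3 * ε := by
  obtain ⟨c, hc, hcpy⟩ := exists_mul_one_sub_two_mul_mul_eq (sq_nonneg ‖p‖) hpy
  refine ⟨c, hc, ?_⟩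
  -- The choice of `c` makes `⟪x, z⟫ = ‖x‖ ^ 2`, as the halving inequality requires.
  set x := p + (c : 𝕜) • y with hx
  set z := ((1 - c : ℝ) : 𝕜) • y with hz
  have hxz : x + z = p + y := by
    rw [hx, hz]
    push_cast
    module
  obtain ⟨q, hq, hqx⟩ := exists_mem_orthogonal_norm_eq hS
    (hF.sup (Submodule.fg_span_singleton y)) (norm_nonneg x)
  rw [← Submodule.inf_orthogonal] at hq
  have hyq : inner 𝕜 y q = 0 := Submodule.mem_orthogonal_singleton_iff_inner_right.1 hq.2
  have hzF : z ∈ Fᗮ := Submodule.smul_mem _ _ hy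
  have hxq : inner 𝕜 x q = 0 := by
    rw [inner_add_left, inner_smul_left, hq.1 p hp, hyq, mul_zero, add_zero]
  have hqz : inner 𝕜 q z = 0 := by
    rw [inner_smul_right, inner_eq_zero_symm.1 hyq, mul_zero]
  have hhalf := hs.two_mul_apply_line_add_le hxq hqz
    (inner_add_smul_smul_eq_norm_sq (hy p hp) hcpy) hqx
  rw [hxz] at hhalf
  linarith [hε q hq.1, hε _ (sub_mem hzF hq.1), hε _ (add_mem hzF hq.1)]

theorem apply_line_add_le_of_norm_le (hs : L.IsState s) (hS : ¬ FiniteDimensional 𝕜 S)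
    {F : Submodule 𝕜 S} (hF : F.FG) {ε : ℝ} (hε : ∀ z ∈ Fᗮ, (s (L.line z) : ℝ) ≤ ε) {p : S}
    (hp : p ∈ F) (k : ℕ) {y : S} (hy : y ∈ Fᗮ) (hpy : 4 ^ k * ‖p‖ ≤ ‖y‖) :
    (s (L.line (p + y)) : ℝ) ≤ (1 / 2) ^ k + 3 * ε := by
  induction k generalizing y with
  | zero =>
    have hε0 : 0 ≤ ε := (s _).2.1.trans (hε 0 (zero_mem _))
    rw [pow_zero]
    linarith [(s (L.line (p + y))).2.2]
  | succ k ih =>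
    have hpow : (1 : ℝ) ≤ 4 ^ k := one_le_pow₀ (by norm_num)
    have h4 : 4 * ‖p‖ ≤ ‖y‖ := by
      rw [pow_succ] at hpy
      nlinarith [norm_nonneg p]
    obtain ⟨c, hc, hle⟩ := hs.exists_two_mul_apply_line_add_le hS hF hε hp hy
      (by nlinarith [norm_nonneg p])
    have hcy : 4 ^ k * ‖p‖ ≤ ‖(c : 𝕜) • y‖ := by
      rw [norm_smul, RCLike.norm_ofReal, abs_of_nonneg (by linarith)]
      rw [pow_succ] at hpy
      nlinarith [norm_nonneg y]
    have := ih (Submodule.smul_mem _ _ hy) hcy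
    rw [pow_succ]
    linarith

section DenseEmbedding

variable {H : Type*} [NormedAddCommGroup H] [InnerProductSpace 𝕜 H] {ι : S →ₗᵢ[𝕜] H} {v : H}

theorem exists_compl_ofFG_lt (hs : L.IsState s) (hc : OContinuous s) (hι : DenseRange ι)
    (hv : v ∉ Set.range ι) {ε : ℝ} (hε : 0 < ε) :
    ∃ F : FGSub (hyperplaneTrace ι v), (s (L.ofFG F.2.1).compl : ℝ) < ε := by
  have hbot : (hyperplaneTrace ι v)ᗮ = ⊥ := by
    simpa only [Submodule.bot_orthogonal_eq_top, top_inf_eq] using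
      orthogonal_inf_hyperplaneTrace hι Submodule.fg_bot hv
  have hconv : OConverges (fun F : FGSub (hyperplaneTrace ι v) => (L.ofFG F.2.1).compl) ⊥ :=
    oConverges_of_le_compl_ofFG (G := ⊥) hbot (fun _ => bot_le) fun _ => le_rfl
  have hlim := tendsto_subtype_rng.1 (hc _ _ _ hconv).tendsto
  rw [hs.apply_bot] at hlim
  exact (hlim.eventually_lt_const hε).exists

theorem apply_line_le_of_not_surjective (hs : L.IsState s) (hc : OContinuous s)
    (hS : ¬ FiniteDimensional 𝕜 S) (hι : DenseRange ι) (hsurj : ¬ Function.Surjective ι) (e : S)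
    (k : ℕ) {ε : ℝ} (hε : 0 < ε) : (s (L.line e) : ℝ) ≤ (1 / 2) ^ k + 3 * ε := by
  rcases eq_or_ne e 0 with rfl | he
  · have hzero : (s (L.line 0) : ℝ) ≤ s ⊥ := hs.apply_line_le (Submodule.zero_mem _)
    rw [hs.apply_bot] at hzero
    exact hzero.trans (by positivity)
  have hη : 0 < ‖e‖ / (4 ^ k + 1) := by positivity
  obtain ⟨v, hv, hve⟩ := exists_notMem_range_norm_sub_lt hsurj (ι e) hη
  obtain ⟨F, hF⟩ := hs.exists_compl_ofFG_lt hc hι hv hε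
  have : FiniteDimensional 𝕜 F.1 := Module.Finite.iff_fg.2 F.2.1
  set p := F.1.starProjection e
  have hp : (4 ^ k + 1) * ‖p‖ ≤ ‖e‖ := by
    rw [norm_sub_rev] at hve
    rw [← le_div_iff₀' (by positivity)]
    exact (norm_starProjection_le_of_le_hyperplaneTrace F.2.2 e).trans hve.le
  have hsmall : ∀ z ∈ F.1ᗮ, (s (L.line z) : ℝ) ≤ ε := fun z hz =>
    (hs.apply_line_le (M := (L.ofFG F.2.1).compl) hz).trans hF.le
  have hbound := hs.apply_line_add_le_of_norm_le hS F.2.1 hsmall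
    (F.1.starProjection_apply_mem e) k (F.1.sub_starProjection_mem_orthogonal e)
    (by linarith [norm_sub_norm_le e p])
  rwa [add_sub_cancel] at hbound

theorem apply_line_eq_zero_of_not_surjective (hs : L.IsState s) (hc : OContinuous s)
    (hS : ¬ FiniteDimensional 𝕜 S) (hι : DenseRange ι) (hsurj : ¬ Function.Surjective ι)
    (e : S) : (s (L.line e) : ℝ) = 0 := by
  refine le_antisymm (le_of_forall_pos_lt_add fun δ hδ => ?_) (s _).2.1
  obtain ⟨k, hk⟩ := exists_pow_lt_of_lt_one (half_pos hδ) (by norm_num : (1 / 2 : ℝ) < 1)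
  linarith [hs.apply_line_le_of_not_surjective hc hS hι hsurj e k (ε := δ / 6) (by positivity)]

end DenseEmbedding

theorem nontrivial (hs : L.IsState s) : Nontrivial S := by
  by_contra hS
  rw [not_nontrivial_iff_subsingleton] at hS
  have htop : s ⊤ = s ⊥ := congrArg s (Subtype.ext (Subsingleton.elim _ _))
  have hone : (s ⊤ : ℝ) = 1 := hs.top_eq_one
  rw [htop, hs.apply_bot] at hone
  exact zero_ne_one hone

theorem completeSpace (hs : L.IsState s) (hc : OContinuous s) : CompleteSpace S := by
  by_contra hS
  have hfin : ¬ FiniteDimensional 𝕜 S := fun _ => hS (FiniteDimensional.complete 𝕜 S)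
  have hsurj := not_surjective_toComplₗᵢ (𝕜 := 𝕜) hS
  obtain ⟨v, hv, -⟩ := exists_notMem_range_norm_sub_lt hsurj 0 one_pos
  obtain ⟨F, hF⟩ := hs.exists_compl_ofFG_lt hc Completion.denseRange_coe hv one_pos
  have hF0 := hs.apply_ofFG_eq_zero
    (hs.apply_line_eq_zero_of_not_surjective hc hfin Completion.denseRange_coe hsurj) F.2.1
  linarith [hs.apply_add_apply_compl (A := L.ofFG F.2.1) F.2.1]

end IsState

end PreHilbertSpaceLogic

end State

theorem nontrivial_of_orthogonalDim_ne_zero {𝕜 : Type*} [RCLike 𝕜] {S : Type*}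
    [NormedAddCommGroup S] [InnerProductSpace 𝕜 S] (h : orthogonalDim 𝕜 S ≠ 0) :
    Nontrivial S := by
  by_contra hS
  rw [not_nontrivial_iff_subsingleton] at hS
  have hempty : IsMONS 𝕜 (∅ : Set S) :=
    ⟨⟨fun a => a.2.elim, fun a => a.2.elim⟩, fun x _ => Subsingleton.elim x 0⟩
  exact h (hempty.mk_eq_orthogonalDim.symm.trans (Cardinal.mk_eq_zero _))

theorem mainTheorem1_general {𝕜 : Type*} [RCLike 𝕜] {S : Type*} [NormedAddCommGroup S]
    [InnerProductSpace 𝕜 S] (L : PreHilbertSpaceLogic 𝕜 S) :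
    ((∃ s : L.Elem → Set.Icc (0 : ℝ) 1, L.IsState s ∧ OContinuous s) ↔
      Nontrivial S ∧ CompleteSpace S) ∧
    (CompleteSpace S → @T2Space L.Elem (oTopology L.Elem)) ∧
    (orthogonalDim 𝕜 S ≤ Cardinal.aleph0 → @T2Space L.Elem (oTopology L.Elem) →
      CompleteSpace S) :=
  ⟨⟨fun ⟨_, hs, hc⟩ => ⟨hs.nontrivial, hs.completeSpace hc⟩,
    fun ⟨_, _⟩ => L.exists_oContinuous_state⟩,
    fun _ => L.t2Space_of_completeSpace, PreHilbertSpaceLogic.completeSpace_of_t2Space⟩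

theorem mainTheorem1 {𝕜 : Type*} [RCLike 𝕜] {S : Type*} [NormedAddCommGroup S]
    [InnerProductSpace 𝕜 S] (L : PreHilbertSpaceLogic 𝕜 S) :
    (orthogonalDim 𝕜 S = Cardinal.aleph0 →
      [@T2Space L.Elem (oTopology L.Elem),
        CompleteSpace S,
        ∃ s : L.Elem → Set.Icc (0 : ℝ) 1, L.IsState s ∧ OContinuous s].TFAE) ∧
    (Nontrivial S → CompleteSpace S →
      ∃ s : L.Elem → Set.Icc (0 : ℝ) 1, L.IsState s ∧ OContinuous s) ∧
    ((∃ s : L.Elem → Set.Icc (0 : ℝ) 1, L.IsState s ∧ OContinuous s) →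
      @T2Space L.Elem (oTopology L.Elem)) := by
  obtain ⟨hState, hT2, hComplete⟩ := mainTheorem1_general L
  refine ⟨fun hdim => ?_, fun hS hcS => hState.2 ⟨hS, hcS⟩, fun h => hT2 (hState.1 h).2⟩
  have hS : Nontrivial S :=
    nontrivial_of_orthogonalDim_ne_zero (𝕜 := 𝕜) (hdim ▸ Cardinal.aleph0_ne_zero)
  tfae_have 1 → 2 := hComplete hdim.le
  tfae_have 2 → 3 := fun hcS => hState.2 ⟨hS, hcS⟩
  tfae_have 3 → 1 := fun h => hT2 (hState.1 h).2
  tfae_finish
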